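/- Let $k$ be a field, let $H$ be a Hopf algebra over $k$ and let $B$ be a Hopf algebra in the category ${}_H^H\mathcal{YD}$ of left-left Yetter-Drinfel'd modules over $H$: thus $B$ is a $k$-algebra, a $k$-coalgebra, a left $H$-module algebra and module coalgebra, a left $H$-comodule algebra and comodule coalgebra (with coaction $\rho(b)=b_{(-1)}\otimes b_{(0)}$), the counit $\epsilon_B$ is an algebra map, $\Delta(1)=1\otimes 1$, $\Delta(bb')=b_{(1)}(b_{(2)(-1)}\cdot b'_{(1)})\otimes b_{(2)(0)}b'_{(2)}$, the Yetter-Drinfel'd condition $h_{(1)}b_{(-1)}\otimes h_{(2)}\cdot b_{(0)}=(h_{(1)}\cdot b)_{(-1)}h_{(2)}\otimes (h_{(1)}\cdot b)_{(0)}$ holds, and $\mathrm{Id}_B$ has a convolution inverse. Let $A=B\times H$ be the biproduct, that is, the vector space $B\otimes H$ (with tensors written $b\times h$) with the smash product multiplication $(b\times h)(b'\times h')=b(h_{(1)}\cdot b')\times h_{(2)}h'$, unit $1\times 1$, the smash coproduct $\Delta(b\times h)=(b_{(1)}\times b_{(2)(-1)}h_{(1)})\otimes(b_{(2)(0)}\times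 h_{(2)})$, and counit $\epsilon(b\times h)=\epsilon(b)\epsilon(h)$. Let $\pi:A\to H$, $\pi(b\times h)=\epsilon(b)h$; $\Pi:A\to B$, $\Pi(b\times h)=b\,\epsilon(h)$; $j:H\to A$, $j(h)=1\times h$; $J:B\to A$, $J(b)=b\times 1$. Let $\mathrm{Aut}_{\mathrm{Hopf}}(A,\pi)$ be the group of Hopf algebra automorphisms $F$ of $A$ with $\pi\circ F=\pi$, and for such $F$ put $F_L=\Pi\circ F\circ J:B\to B$ and $F_R=\Pi\circ F\circ j:H\to B$. Then $\nu(F)=F_L$ defines a group homomorphism $\nu:\mathrm{Aut}_{\mathrm{Hopf}}(A,\pi)\to\mathrm{Aut}_{\mathrm{Alg}}(B)$, and the set $\mathcal{N}(B,H)$ of all $F_R$ with $F\in\mathrm{Aut}_{\mathrm{Hopf}}(A,\pi)$ and $F_L=\mathrm{Id}_B$ is a group under the convolution product of $\mathrm{Hom}(H,B)$. Let $\mathrm{Aut}_{\mathcal{YD}\text{-}\mathrm{Hopf}}(B)$ be the group of bijective linear maps $B\to B$ which are maps of algebras, coalgebras, left $H$-modules and left $H$-comodules, and let $\mathrm{Sym}(A)$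 be the group of all permutations of the set $A$. Suppose that $H$ is cocommutative. Then $\varphi(f)(g)=f\circ g$ defines an action $\varphi$ of the group $\mathrm{Im}(\nu)$ on $\mathcal{N}(B,H)^{op}$ by group automorphisms, and: (a) There is an injective group homomorphism $\Phi_\nu:\mathcal{N}(B,H)^{op}\rtimes_\varphi\mathrm{Im}(\nu)\to\mathrm{Sym}(A)$ given by $\Phi_\nu(g,f)(b\times h)=f(b)g(h_{(1)})\times h_{(2)}$ for all $b\in B$, $h\in H$, each map $\Phi_\nu(g,f)$ being $k$-linear. (b) For every $(g,f)\in\mathcal{N}(B,H)^{op}\rtimes_\varphi\mathrm{Im}(\nu)$ one has $\Phi_\nu(g,f)\in\mathrm{Aut}_{\mathrm{Hopf}}(A,\pi)$ if and only if $f\in\mathrm{Aut}_{\mathcal{YD}\text{-}\mathrm{Hopf}}(B)$. -/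

import Mathlib

open scoped TensorProduct

noncomputable section

namespace RadfordBiproduct

open TensorProduct Coalgebra

section Maps

variable (k H B : Type*) [Field k] [Ring H] [HopfAlgebra k H] [Ring B] [Algebra k B]
  [Module H B] [IsScalarTower k H B]

/-- The action as a linear map, `h ⊗ b ↦ h • b`. -/
def act : H ⊗[k] B →ₗ[k] B := TensorProduct.lift (Algebra.lsmul k k B : H →ₐ[k] Module.End k B).toLinearMap

@[simp] theorem act_tmul (h : H) (b : B) : act k H B (h ⊗ₜ b) = h • b := rfl

variable {B} in
/-- The orbit map of `b`, that is `h ↦ h • b`. -/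
def orb (b : B) : H →ₗ[k] B := act k H B ∘ₗ (TensorProduct.mk k H B).flip b

@[simp] theorem orb_apply (b : B) (h : H) : orb k H b h = h • b := rfl

end Maps

/-- For `c : Y ⊗ Z → Z' ⊗ Y'`, the map `(X ⊗ Y) ⊗ (Z ⊗ W) → (X ⊗ Z') ⊗ (Y' ⊗ W)` which applies `c`
to the two middle tensor factors. -/
def middle (k : Type*) [Field k] {X Y Z W Y' Z' : Type*} [AddCommGroup X] [AddCommGroup Y]
    [AddCommGroup Z] [AddCommGroup W] [AddCommGroup Y'] [AddCommGroup Z'] [Module k X] [Module k Y]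
    [Module k Z] [Module k W] [Module k Y'] [Module k Z'] (c : Y ⊗[k] Z →ₗ[k] Z' ⊗[k] Y') :
    (X ⊗[k] Y) ⊗[k] (Z ⊗[k] W) →ₗ[k] (X ⊗[k] Z') ⊗[k] (Y' ⊗[k] W) :=
  (TensorProduct.assoc k X Z' (Y' ⊗[k] W)).symm.toLinearMap ∘ₗ
    ((TensorProduct.assoc k Z' Y' W).toLinearMap ∘ₗ c.rTensor W ∘ₗ
      (TensorProduct.assoc k Y Z W).symm.toLinearMap).lTensor X ∘ₗ
    (TensorProduct.assoc k X Y (Z ⊗[k] W)).toLinearMap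

/-- The Yetter-Drinfel'd braiding of `B` with itself, `x ⊗ y ↦ x₍₋₁₎ • y ⊗ x₍₀₎`, for the linear map
`ρ : x ↦ x₍₋₁₎ ⊗ x₍₀₎`. -/
def braiding (k H B : Type*) [Field k] [Ring H] [HopfAlgebra k H] [Ring B] [Algebra k B]
    [Module H B] [IsScalarTower k H B] (ρ : B →ₗ[k] H ⊗[k] B) : B ⊗[k] B →ₗ[k] B ⊗[k] B :=
  (act k H B).rTensor B ∘ₗ (TensorProduct.assoc k H B B).symm.toLinearMap ∘ₗ
    (TensorProduct.comm k B B).toLinearMap.lTensor H ∘ₗ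
    (TensorProduct.assoc k H B B).toLinearMap ∘ₗ ρ.rTensor B

/-- The data and axioms which make `B` (an algebra, a coalgebra and a left `H`-module over `k`) a
Hopf algebra in the category of left-left Yetter-Drinfel'd modules over the Hopf algebra `H`. -/
structure YDHopf (k H B : Type*) [Field k] [Ring H] [HopfAlgebra k H] [Ring B] [Algebra k B]
    [Coalgebra k B] [Module H B] [IsScalarTower k H B] where
  /-- the left `H`-comodule structure `ρ(b) = b₍₋₁₎ ⊗ b₍₀₎` -/
  ρ : B →ₗ[k] H ⊗[k] B
  /-- `ρ` is coassociative -/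
  coact_coassoc : ∀ b, TensorProduct.assoc k H H B ((comul (R := k) (A := H)).rTensor B (ρ b)) =
    ρ.lTensor H (ρ b)
  /-- `ε(b₍₋₁₎) b₍₀₎ = b` -/
  coact_counit : ∀ b, TensorProduct.lid k B ((counit (R := k) (A := H)).rTensor B (ρ b)) = b
  /-- module algebra: `h • 1 = ε(h) 1` -/
  smul_one : ∀ h : H, h • (1 : B) = counit (R := k) h • (1 : B)
  /-- module algebra: `h • (b b') = (h₍₁₎ • b) (h₍₂₎ • b')` -/
  smul_mul : ∀ (h : H) (b b' : B), h • (b * b') =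
    LinearMap.mul' k B (TensorProduct.map (orb k H b) (orb k H b') (comul h))
  /-- module coalgebra: `ε(h • b) = ε(h) ε(b)` -/
  counit_smul : ∀ (h : H) (b : B), counit (R := k) (h • b) = counit (R := k) h * counit (R := k) b
  /-- module coalgebra: `Δ(h • b) = h₍₁₎ • b₍₁₎ ⊗ h₍₂₎ • b₍₂₎` -/
  comul_smul : ∀ (h : H) (b : B), comul (R := k) (h • b) =
    TensorProduct.map (act k H B) (act k H B)
      (TensorProduct.tensorTensorTensorComm k H H B B (comul h ⊗ₜ comul b))
  /-- comodule algebra: `ρ(1) = 1 ⊗ 1` -/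
  coact_one : ρ 1 = 1 ⊗ₜ 1
  /-- comodule algebra: `ρ(b b') = b₍₋₁₎ b'₍₋₁₎ ⊗ b₍₀₎ b'₍₀₎` -/
  coact_mul : ∀ b b', ρ (b * b') = ρ b * ρ b'
  /-- comodule coalgebra: `b₍₋₁₎ ε(b₍₀₎) = ε(b) 1` -/
  counit_coact : ∀ b, TensorProduct.rid k H ((counit (R := k) (A := B)).lTensor H (ρ b)) =
    counit (R := k) b • (1 : H)
  /-- comodule coalgebra:
  `b₍₁₎₍₋₁₎ b₍₂₎₍₋₁₎ ⊗ b₍₁₎₍₀₎ ⊗ b₍₂₎₍₀₎ = b₍₋₁₎ ⊗ b₍₀₎₍₁₎ ⊗ b₍₀₎₍₂₎` -/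
  comul_coact : ∀ b, (LinearMap.mul' k H).rTensor (B ⊗[k] B)
      (TensorProduct.tensorTensorTensorComm k H B H B (TensorProduct.map ρ ρ (comul b))) =
    (comul (R := k) (A := B)).lTensor H (ρ b)
  /-- `ε` is an algebra map -/
  counit_one : counit (R := k) (1 : B) = 1
  /-- `ε` is an algebra map -/
  counit_mul : ∀ b b' : B, counit (R := k) (b * b') = counit (R := k) b * counit (R := k) b'
  /-- `Δ(1) = 1 ⊗ 1` -/
  comul_one : comul (R := k) (1 : B) = 1 ⊗ₜ 1
  /-- `Δ(b b') = b₍₁₎ (b₍₂₎₍₋₁₎ • b'₍₁₎) ⊗ b₍₂₎₍₀₎ b'₍₂₎` -/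
  comul_mul : ∀ b b' : B, comul (R := k) (b * b') =
    TensorProduct.map (LinearMap.mul' k B) (LinearMap.mul' k B)
      (middle k (braiding k H B ρ) (comul b ⊗ₜ comul b'))
  /-- Yetter-Drinfel'd condition:
  `h₍₁₎ b₍₋₁₎ ⊗ h₍₂₎ • b₍₀₎ = (h₍₁₎ • b)₍₋₁₎ h₍₂₎ ⊗ (h₍₁₎ • b)₍₀₎`; the right hand side is the sum of
  the products `ρ(h₍₁₎ • b) (h₍₂₎ ⊗ 1)` in the algebra `H ⊗ B` -/
  yd : ∀ (h : H) (b : B), TensorProduct.map (LinearMap.mul' k H) (act k H B)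
      (TensorProduct.tensorTensorTensorComm k H H H B (comul h ⊗ₜ ρ b)) =
    LinearMap.mul' k (H ⊗[k] B)
      (TensorProduct.map (ρ ∘ₗ orb k H b) ((TensorProduct.mk k H B).flip 1) (comul h))
  /-- the identity map of `B` has a convolution inverse, the antipode of `B` -/
  antipode : IsUnit (WithConv.toConv (LinearMap.id : B →ₗ[k] B))

section Mul

variable (k H B : Type*) [Field k] [Ring H] [HopfAlgebra k H] [Ring B] [Algebra k B]
  [Module H B] [IsScalarTower k H B]

/-- `h ⊗ b ↦ h₍₁₎ • b ⊗ h₍₂₎` -/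
def smashTwist : H ⊗[k] B →ₗ[k] B ⊗[k] H :=
  (act k H B).rTensor H ∘ₗ (TensorProduct.assoc k H B H).symm.toLinearMap ∘ₗ
    (TensorProduct.comm k H B).toLinearMap.lTensor H ∘ₗ
    (TensorProduct.assoc k H H B).toLinearMap ∘ₗ (comul (R := k) (A := H)).rTensor B

/-- The multiplication `(b ⊗ h) (b' ⊗ h') = b (h₍₁₎ • b') ⊗ h₍₂₎ h'`. -/
def smashMul : (B ⊗[k] H) ⊗[k] (B ⊗[k] H) →ₗ[k] B ⊗[k] H :=
  TensorProduct.map (LinearMap.mul' k B) (LinearMap.mul' k H) ∘ₗ middle k (smashTwist k H B)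

variable {k H B}

theorem smashTwist_tmul (h : H) (b : B) :
    smashTwist k H B (h ⊗ₜ b) = (orb k H b).rTensor H (comul h) := by
  simp only [smashTwist, LinearMap.comp_apply, LinearMap.rTensor_tmul]
  induction comul (R := k) h using TensorProduct.induction_on with
  | zero => simp
  | tmul x y => simp
  | add x y hx hy => simp only [TensorProduct.add_tmul, map_add, hx, hy]

theorem smashMul_tmul (b b' : B) (h h' : H) :
    smashMul k H B ((b ⊗ₜ h) ⊗ₜ (b' ⊗ₜ h')) =
      TensorProduct.map (LinearMap.mulLeft k b ∘ₗ orb k H b') (LinearMap.mulRight k h')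
        (comul h) := by
  simp only [smashMul, middle, LinearMap.comp_apply, LinearEquiv.coe_coe, TensorProduct.assoc_tmul,
    LinearMap.lTensor_tmul, TensorProduct.assoc_symm_tmul, LinearMap.rTensor_tmul, smashTwist_tmul]
  induction comul (R := k) h using TensorProduct.induction_on with
  | zero => simp
  | tmul x y => simp
  | add x y hx hy => simp only [TensorProduct.tmul_add, TensorProduct.add_tmul, map_add, hx, hy]

end Mul

variable {k H B : Type*} [Field k] [Ring H] [HopfAlgebra k H] [Ring B] [Algebra k B]
    [Coalgebra k B] [Module H B] [IsScalarTower k H B]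

/-- The underlying vector space `B ⊗ H` of the biproduct `B × H`. -/
@[nolint unusedArguments]
def Biproduct (_D : YDHopf k H B) : Type _ := B ⊗[k] H

variable (D : YDHopf k H B)

instance : AddCommGroup (Biproduct D) := inferInstanceAs (AddCommGroup (B ⊗[k] H))
instance : Module k (Biproduct D) := inferInstanceAs (Module k (B ⊗[k] H))

/-- `B ⊗ H` regarded as the biproduct. -/
def toBi : B ⊗[k] H ≃ₗ[k] Biproduct D := LinearEquiv.refl k (B ⊗[k] H)

theorem ext_tmul {M : Type*} [AddCommMonoid M] [Module k M] {f g : Biproduct D →ₗ[k] M}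
    (h : ∀ b x, f (toBi D (b ⊗ₜ x)) = g (toBi D (b ⊗ₜ x))) : f = g := by
  have : f ∘ₗ (toBi D).toLinearMap = g ∘ₗ (toBi D).toLinearMap := TensorProduct.ext' h
  ext x
  exact LinearMap.congr_fun this x

/-! ### The smash product algebra -/

theorem smash_key (D : YDHopf k H B) (h : H) (b b' c : B) (d : H) :
    TensorProduct.map (LinearMap.mulLeft k b ∘ₗ orb k H (b' * c)) (LinearMap.mulRight k d)
        (comul h) =
      ∑ i ∈ (ℛ k h).index, TensorProduct.map
        (LinearMap.mulLeft k (b * ((ℛ k h).left i • b')) ∘ₗ orb k H c) (LinearMap.mulRight k d)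
        (comul ((ℛ k h).right i)) := by
  let Ψ : H ⊗[k] (H ⊗[k] H) →ₗ[k] B ⊗[k] H :=
    TensorProduct.map (LinearMap.mul' k B) LinearMap.id ∘ₗ
      (TensorProduct.assoc k B B H).symm.toLinearMap ∘ₗ
      TensorProduct.map (LinearMap.mulLeft k b ∘ₗ orb k H b')
        (TensorProduct.map (orb k H c) (LinearMap.mulRight k d))
  have h1 : Ψ (TensorProduct.assoc k H H H ((comul (R := k) (A := H)).rTensor H (comul h))) =
      TensorProduct.map (LinearMap.mulLeft k b ∘ₗ orb k H (b' * c)) (LinearMap.mulRight k d)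
        (comul h) := by
    induction comul (R := k) h using TensorProduct.induction_on with
    | zero => simp
    | tmul x y =>
      simp only [LinearMap.rTensor_tmul, TensorProduct.map_tmul, LinearMap.comp_apply, orb_apply,
        D.smul_mul]
      induction comul (R := k) x using TensorProduct.induction_on with
      | zero => simp
      | tmul u v => simp [Ψ, mul_assoc]
      | add x y hx hy => simp only [TensorProduct.add_tmul, map_add, hx, hy]
    | add x y hx hy => simp only [map_add, hx, hy]
  have h2 : ∀ x y, Ψ (x ⊗ₜ y) = TensorProduct.map
        (LinearMap.mulLeft k (b * (x • b')) ∘ₗ orb k H c) (LinearMap.mulRight k d) y := by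
    intro x y
    induction y using TensorProduct.induction_on with
    | zero => simp
    | tmul u v => simp [Ψ, mul_assoc]
    | add y z hy hz => simp only [TensorProduct.tmul_add, map_add, hy, hz]
  rw [← h1, coassoc_apply]
  conv_lhs => rw [← (ℛ k h).eq]
  simp [h2]

theorem smashMul_assoc (D : YDHopf k H B) (x y z : B ⊗[k] H) :
    smashMul k H B (smashMul k H B (x ⊗ₜ y) ⊗ₜ z) =
      smashMul k H B (x ⊗ₜ smashMul k H B (y ⊗ₜ z)) := by
  induction x using TensorProduct.induction_on with
  | zero => simp
  | add x x' hx hx' => simp only [TensorProduct.add_tmul, map_add, hx, hx']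
  | tmul b h =>
  induction y using TensorProduct.induction_on with
  | zero => simp
  | add x x' hx hx' => simp only [TensorProduct.tmul_add, TensorProduct.add_tmul, map_add, hx, hx']
  | tmul b' h' =>
  induction z using TensorProduct.induction_on with
  | zero => simp
  | add x x' hx hx' => simp only [TensorProduct.tmul_add, map_add, hx, hx']
  | tmul b'' h'' =>
  rw [smashMul_tmul b', ← (ℛ k h').eq]
  simp only [map_sum, TensorProduct.tmul_sum, TensorProduct.map_tmul, LinearMap.comp_apply,
    orb_apply, LinearMap.mulLeft_apply, LinearMap.mulRight_apply]
  simp only [smashMul_tmul b b', smashMul_tmul b (b' * _), smash_key D]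
  conv_lhs => rw [← (ℛ k h).eq]
  simp only [map_sum, TensorProduct.sum_tmul, TensorProduct.map_tmul, LinearMap.comp_apply,
    orb_apply, LinearMap.mulLeft_apply, LinearMap.mulRight_apply]
  conv_rhs => rw [Finset.sum_comm]
  refine Finset.sum_congr rfl fun i _ => ?_
  rw [smashMul_tmul, Bialgebra.comul_mul, ← (ℛ k h').eq, Finset.mul_sum, map_sum]
  refine Finset.sum_congr rfl fun j _ => ?_
  induction comul (R := k) ((ℛ k h).right i) using TensorProduct.induction_on with
  | zero => simp
  | add x x' hx hx' => simp only [add_mul, map_add, hx, hx']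
  | tmul u v => simp [mul_assoc, mul_smul]

theorem smash_one_mul (x : B ⊗[k] H) : smashMul k H B ((1 ⊗ₜ 1) ⊗ₜ x) = x := by
  induction x using TensorProduct.induction_on with
  | zero => simp
  | add x x' hx hx' => simp only [TensorProduct.tmul_add, map_add, hx, hx']
  | tmul b h => simp [smashMul_tmul, Algebra.TensorProduct.one_def]

theorem smash_mul_one (D : YDHopf k H B) (x : B ⊗[k] H) : smashMul k H B (x ⊗ₜ (1 ⊗ₜ 1)) = x := by
  induction x using TensorProduct.induction_on with
  | zero => simp
  | add x x' hx hx' => simp only [TensorProduct.add_tmul, map_add, hx, hx']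
  | tmul b h =>
    rw [smashMul_tmul]
    conv_rhs => rw [← sum_counit_smul (ℛ k h)]
    conv_lhs => rw [← (ℛ k h).eq]
    simp [D.smul_one, TensorProduct.tmul_sum, TensorProduct.smul_tmul]

instance : Mul (Biproduct D) :=
  ⟨fun x y => toBi D (smashMul k H B ((toBi D).symm x ⊗ₜ (toBi D).symm y))⟩

instance : One (Biproduct D) := ⟨toBi D (1 ⊗ₜ 1)⟩

theorem mul_def (x y : Biproduct D) :
    x * y = toBi D (smashMul k H B ((toBi D).symm x ⊗ₜ (toBi D).symm y)) := rfl

theorem one_def : (1 : Biproduct D) = toBi D (1 ⊗ₜ 1) := rfl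

/-- The smash product algebra `B # H`. -/
instance : Ring (Biproduct D) :=
  { (inferInstance : AddCommGroup (Biproduct D)), (inferInstance : Mul (Biproduct D)),
    (inferInstance : One (Biproduct D)) with
    left_distrib := fun x y z => by simp [mul_def, TensorProduct.tmul_add]
    right_distrib := fun x y z => by simp [mul_def, TensorProduct.add_tmul]
    zero_mul := fun x => by simp [mul_def]
    mul_zero := fun x => by simp [mul_def]
    mul_assoc := fun x y z => by simp [mul_def, smashMul_assoc D]
    one_mul := fun x => by simp [mul_def, one_def, smash_one_mul]
    mul_one := fun x => by simp [mul_def, one_def, smash_mul_one D] }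

instance : Algebra k (Biproduct D) :=
  Algebra.ofModule (fun c x y => by simp [mul_def, ← TensorProduct.smul_tmul'])
    (fun c x y => by simp [mul_def])

/-! ### The smash coproduct coalgebra -/

/-- `Δ(b ⊗ h) = (b₍₁₎ ⊗ b₍₂₎₍₋₁₎ h₍₁₎) ⊗ (b₍₂₎₍₀₎ ⊗ h₍₂₎)` on the vector space `B ⊗ H`. -/
def smashComul : B ⊗[k] H →ₗ[k] (B ⊗[k] H) ⊗[k] (B ⊗[k] H) :=
  (TensorProduct.assoc k B H (B ⊗[k] H)).symm.toLinearMap ∘ₗ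
    ((LinearMap.mul' k H).rTensor (B ⊗[k] H) ∘ₗ
      (TensorProduct.tensorTensorTensorComm k H B H H).toLinearMap ∘ₗ
      TensorProduct.map D.ρ comul).lTensor B ∘ₗ
    (TensorProduct.assoc k B B H).toLinearMap ∘ₗ (comul (R := k) (A := B)).rTensor H

/-- The smash coproduct, with `ε(b ⊗ h) = ε(b) ε(h)`. -/
instance : CoalgebraStruct k (Biproduct D) where
  comul := TensorProduct.map (toBi D).toLinearMap (toBi D).toLinearMap ∘ₗ smashComul D ∘ₗ
    (toBi D).symm.toLinearMap
  counit := LinearMap.mul' k k ∘ₗ TensorProduct.map counit counit ∘ₗ (toBi D).symm.toLinearMap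

/-! ### The maps between `A = B × H` and its factors -/

/-- `π : A → H`, `π(b × h) = ε(b) h`. -/
def projH : Biproduct D →ₗ[k] H :=
  (TensorProduct.lid k H).toLinearMap ∘ₗ (counit (R := k) (A := B)).rTensor H ∘ₗ
    (toBi D).symm.toLinearMap

/-- `Π : A → B`, `Π(b × h) = ε(h) b`. -/
def projB : Biproduct D →ₗ[k] B :=
  (TensorProduct.rid k B).toLinearMap ∘ₗ (counit (R := k) (A := H)).lTensor B ∘ₗ
    (toBi D).symm.toLinearMap

/-- `j : H → A`, `j(h) = 1 × h`. -/
def inclH : H →ₗ[k] Biproduct D := (toBi D).toLinearMap ∘ₗ TensorProduct.mk k B H 1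

/-- `J : B → A`, `J(b) = b × 1`. -/
def inclB : B →ₗ[k] Biproduct D := (toBi D).toLinearMap ∘ₗ (TensorProduct.mk k B H).flip 1

@[simp] theorem projH_tmul (b : B) (h : H) :
    projH D (toBi D (b ⊗ₜ h)) = counit (R := k) b • h := by simp [projH]

@[simp] theorem projB_tmul (b : B) (h : H) :
    projB D (toBi D (b ⊗ₜ h)) = counit (R := k) h • b := by simp [projB]

theorem inclH_apply (h : H) : inclH D h = toBi D (1 ⊗ₜ h) := rfl

theorem inclB_apply (b : B) : inclB D b = toBi D (b ⊗ₜ 1) := rfl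

@[simp] theorem projB_inclB (b : B) : projB D (inclB D b) = b := by simp [inclB_apply]

/-! ### Automorphisms -/

/-- `Aut_Hopf(A, π)`: the automorphisms `F` of the Hopf algebra `A` with `π ∘ F = π`. -/
def autHopf : Subgroup (Biproduct D ≃ₗ[k] Biproduct D) where
  carrier := {F | (∃ E : Biproduct D ≃ₐc[k] Biproduct D, ∀ a, E a = F a) ∧
    ∀ a, projH D (F a) = projH D a}
  mul_mem' := by
    rintro F G ⟨⟨E, hE⟩, hF⟩ ⟨⟨E', hE'⟩, hG⟩
    exact ⟨⟨E'.trans E, fun a => (congrArg E (hE' a)).trans (hE _)⟩, fun a => (hF _).trans (hG a)⟩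
  one_mem' := ⟨⟨BialgEquiv.refl k _, fun a => rfl⟩, fun a => rfl⟩
  inv_mem' := by
    rintro F ⟨⟨E, hE⟩, hF⟩
    refine ⟨⟨E.symm, fun a => ?_⟩, fun a => ?_⟩
    · apply F.injective
      rw [← hE]
      simp
    · rw [← hF]
      simp

/-- `Aut_{YD-Hopf}(B)`: the automorphisms of `B` as an algebra, coalgebra, left `H`-module and left
`H`-comodule. -/
def autYDHopf : Subgroup (B ≃ₐ[k] B) where
  carrier := {f | (∃ E : B ≃ₐc[k] B, ∀ b, E b = f b) ∧ (∀ (h : H) (b : B), f (h • b) = h • f b) ∧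
    ∀ b, D.ρ (f b) = f.toLinearMap.lTensor H (D.ρ b)}
  mul_mem' := by
    rintro f g ⟨⟨E, hE⟩, hf, hf'⟩ ⟨⟨E', hE'⟩, hg, hg'⟩
    refine ⟨⟨E'.trans E, fun a => (congrArg E (hE' a)).trans (hE _)⟩, fun h b => by simp [hf, hg], fun b => ?_⟩
    rw [AlgEquiv.mul_apply, hf', hg', ← LinearMap.comp_apply, ← LinearMap.lTensor_comp]
    rfl
  one_mem' := ⟨⟨BialgEquiv.refl k _, fun a => rfl⟩, fun _ _ => rfl, fun b => by
    have : (1 : B ≃ₐ[k] B).toLinearMap = LinearMap.id := rfl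
    simp [this]⟩
  inv_mem' := by
    rintro f ⟨⟨E, hE⟩, hf, hf'⟩
    have hi : ∀ b, f (f⁻¹ b) = b := fun b => f.apply_symm_apply b
    have hi' : (f⁻¹).toLinearMap ∘ₗ f.toLinearMap = LinearMap.id :=
      LinearMap.ext fun b => f.symm_apply_apply b
    refine ⟨⟨E.symm, fun a => ?_⟩, fun h b => ?_, fun b => ?_⟩
    · apply f.injective
      rw [← hE]
      simp
    · apply f.injective
      rw [hf, hi, hi]
    · conv_rhs => rw [← hi b, hf', ← LinearMap.comp_apply, ← LinearMap.lTensor_comp, hi']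
      simp

/-! ### The factors of an automorphism -/

/-- `F_L = Π ∘ F ∘ J`. -/
def facL (F : Biproduct D ≃ₗ[k] Biproduct D) : B →ₗ[k] B :=
  projB D ∘ₗ F.toLinearMap ∘ₗ inclB D

/-- `F_R = Π ∘ F ∘ j`. -/
def facR (F : Biproduct D ≃ₗ[k] Biproduct D) : H →ₗ[k] B :=
  projB D ∘ₗ F.toLinearMap ∘ₗ inclH D

theorem facL_apply (F : Biproduct D ≃ₗ[k] Biproduct D) (b : B) :
    facL D F b = projB D (F (inclB D b)) := rfl

theorem facR_apply (F : Biproduct D ≃ₗ[k] Biproduct D) (h : H) :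
    facR D F h = projB D (F (inclH D h)) := rfl

theorem comul_proj_aux (r : H ⊗[k] B) (t : H ⊗[k] H) :
    ((TensorProduct.lid k H).toLinearMap ∘ₗ (counit (R := k) (A := B)).rTensor H).lTensor H
      ((LinearMap.mul' k H).rTensor (B ⊗[k] H)
        (TensorProduct.tensorTensorTensorComm k H B H H (r ⊗ₜ t))) =
      (TensorProduct.rid k H ((counit (R := k) (A := B)).lTensor H r) ⊗ₜ[k] (1 : H)) * t := by
  induction r using TensorProduct.induction_on with
  | zero => simp
  | add x y hx hy => simp only [TensorProduct.add_tmul, map_add, hx, hy, add_mul]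
  | tmul x y =>
  induction t using TensorProduct.induction_on with
  | zero => simp
  | add x y hx hy => simp only [TensorProduct.tmul_add, map_add, hx, hy, mul_add]
  | tmul u v => simp [TensorProduct.smul_tmul]

theorem comul_proj (b : B) (h : H) :
    (projH D).lTensor (Biproduct D) (comul (toBi D (b ⊗ₜ h))) =
      ((toBi D).toLinearMap ∘ₗ TensorProduct.mk k B H b).rTensor H (comul h) := by
  have key : ∀ z : B ⊗[k] B, (projH D).lTensor (Biproduct D)
      (TensorProduct.map (toBi D).toLinearMap (toBi D).toLinearMap
        ((TensorProduct.assoc k B H (B ⊗[k] H)).symm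
          (((LinearMap.mul' k H).rTensor (B ⊗[k] H) ∘ₗ
            (TensorProduct.tensorTensorTensorComm k H B H H).toLinearMap ∘ₗ
            TensorProduct.map D.ρ comul).lTensor B
              (TensorProduct.assoc k B B H (z ⊗ₜ h))))) =
      ((toBi D).toLinearMap ∘ₗ TensorProduct.mk k B H
        (TensorProduct.rid k B ((counit (R := k) (A := B)).lTensor B z))).rTensor H (comul h) := by
    intro z
    induction z using TensorProduct.induction_on with
    | zero => simp
    | add x y hx hy =>
      simp only [TensorProduct.add_tmul, map_add, hx, hy, LinearMap.comp_add, LinearMap.rTensor_add,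
        LinearMap.add_apply]
    | tmul x y =>
      have h1 : ∀ w : H ⊗[k] (B ⊗[k] H), (projH D).lTensor (Biproduct D)
          (TensorProduct.map (toBi D).toLinearMap (toBi D).toLinearMap
            ((TensorProduct.assoc k B H (B ⊗[k] H)).symm (x ⊗ₜ w))) =
          ((toBi D).toLinearMap ∘ₗ TensorProduct.mk k B H x).rTensor H
            (((TensorProduct.lid k H).toLinearMap ∘ₗ
              (counit (R := k) (A := B)).rTensor H).lTensor H w) := by
        intro w
        induction w using TensorProduct.induction_on with
        | zero => simp
        | add x y hx hy => simp only [TensorProduct.tmul_add, map_add, hx, hy]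
        | tmul u v => simp [projH]
      simp only [TensorProduct.assoc_tmul, LinearMap.lTensor_tmul, LinearMap.comp_apply,
        TensorProduct.map_tmul, LinearEquiv.coe_coe, h1]
      rw [comul_proj_aux, D.counit_coact, ← TensorProduct.smul_tmul', smul_mul_assoc,
        ← Algebra.TensorProduct.one_def, one_mul, map_smul,
        TensorProduct.rid_tmul, map_smul, LinearMap.comp_smul, LinearMap.rTensor_smul,
        LinearMap.smul_apply]
  have := key (comul b)
  rw [lTensor_counit_comul, TensorProduct.rid_tmul, one_smul] at this
  exact this

theorem autHopf_tmul {F : Biproduct D ≃ₗ[k] Biproduct D} (hF : F ∈ autHopf D) (b : B) (h : H) :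
    F (toBi D (b ⊗ₜ h)) = toBi D
      ((projB D ∘ₗ F.toLinearMap ∘ₗ (toBi D).toLinearMap ∘ₗ TensorProduct.mk k B H b).rTensor H
        (comul h)) := by
  have recon : ∀ a : Biproduct D,
      toBi D ((projB D).rTensor H ((projH D).lTensor (Biproduct D) (comul a))) = a := by
    intro a
    refine LinearMap.congr_fun (f := (toBi D).toLinearMap ∘ₗ (projB D).rTensor H ∘ₗ
      (projH D).lTensor (Biproduct D) ∘ₗ comul) (g := LinearMap.id) (ext_tmul D fun b h => ?_) a
    simp only [LinearMap.comp_apply, LinearEquiv.coe_coe, comul_proj, LinearMap.id_apply]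
    rw [← LinearMap.comp_apply, ← LinearMap.rTensor_comp]
    conv_rhs => rw [← sum_counit_smul (ℛ k h)]
    conv_lhs => rw [← (ℛ k h).eq]
    simp [TensorProduct.tmul_sum, TensorProduct.smul_tmul]
  obtain ⟨⟨E, hE⟩, hπ⟩ := hF
  have hc : ∀ a, comul (R := k) (F a) = TensorProduct.map F.toLinearMap F.toLinearMap (comul a) := by
    intro a
    have hEF : ((E : Biproduct D →ₗc[k] Biproduct D) : Biproduct D →ₗ[k] Biproduct D) =
        F.toLinearMap := LinearMap.ext hE
    have := CoalgHomClass.map_comp_comul_apply E a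
    rw [← hE]
    rw [← this, ← hEF]
    rfl
  have hπ' : projH D ∘ₗ F.toLinearMap = projH D := LinearMap.ext hπ
  rw [← recon (F _), hc, ← LinearMap.comp_apply (LinearMap.lTensor _ _), LinearMap.lTensor_comp_map,
    hπ']
  have h2 : TensorProduct.map F.toLinearMap (projH D) =
      F.toLinearMap.rTensor H ∘ₗ (projH D).lTensor (Biproduct D) := by
    rw [LinearMap.rTensor_comp_lTensor]
  rw [h2, LinearMap.comp_apply, comul_proj, ← LinearMap.comp_apply, ← LinearMap.comp_apply,
    ← LinearMap.rTensor_comp, ← LinearMap.rTensor_comp]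
  rfl

theorem autHopf_inclB {F : Biproduct D ≃ₗ[k] Biproduct D} (hF : F ∈ autHopf D) (b : B) :
    F (inclB D b) = inclB D (facL D F b) := by
  rw [inclB_apply, autHopf_tmul D hF]
  simp [Algebra.TensorProduct.one_def, inclB_apply, facL_apply]

theorem autHopf_inclH {F : Biproduct D ≃ₗ[k] Biproduct D} (hF : F ∈ autHopf D) (h : H) :
    F (inclH D h) = toBi D ((facR D F).rTensor H (comul h)) := by
  rw [inclH_apply, autHopf_tmul D hF]
  rfl

theorem inclB_mul_toBi (b b' : B) (h : H) :
    inclB D b * toBi D (b' ⊗ₜ h) = toBi D ((b * b') ⊗ₜ h) := by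
  simp [mul_def, inclB_apply, smashMul_tmul, Algebra.TensorProduct.one_def]

theorem inclB_mul (b b' : B) : inclB D (b * b') = inclB D b * inclB D b' :=
  (inclB_mul_toBi D b b' 1).symm

theorem projB_inclB_mul (b : B) (a : Biproduct D) : projB D (inclB D b * a) = b * projB D a := by
  refine LinearMap.congr_fun (f := projB D ∘ₗ LinearMap.mulLeft k (inclB D b))
    (g := LinearMap.mulLeft k b ∘ₗ projB D) (ext_tmul D fun b' h => ?_) a
  simp [inclB_mul_toBi]

theorem autHopf_mul {F : Biproduct D ≃ₗ[k] Biproduct D} (hF : F ∈ autHopf D) (x y : Biproduct D) :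
    F (x * y) = F x * F y := by
  obtain ⟨⟨E, hE⟩, -⟩ := hF
  rw [← hE, ← hE, ← hE, map_mul]

theorem facL_mul {F G : Biproduct D ≃ₗ[k] Biproduct D} (hG : G ∈ autHopf D) :
    facL D (F * G) = facL D F ∘ₗ facL D G := by
  ext b
  rw [LinearMap.comp_apply, facL_apply, LinearEquiv.mul_apply, autHopf_inclB D hG]
  rfl

theorem facL_one : facL D 1 = LinearMap.id := by
  ext b
  simp [facL_apply]

theorem facR_mul {F G : Biproduct D ≃ₗ[k] Biproduct D} (hF : F ∈ autHopf D) (hG : G ∈ autHopf D) :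
    WithConv.toConv (facR D (F * G)) =
      WithConv.toConv (facL D F ∘ₗ facR D G) * WithConv.toConv (facR D F) := by
  ext h
  simp only [LinearMap.convMul_apply, facR_apply D (F * G), LinearEquiv.mul_apply,
    autHopf_inclH D hG]
  induction comul (R := k) h using TensorProduct.induction_on with
  | zero => simp
  | add x y hx hy => simp only [map_add, hx, hy]
  | tmul x y =>
    have : toBi D (facR D G x ⊗ₜ y) = inclB D (facR D G x) * inclH D y := by
      rw [inclH_apply, inclB_mul_toBi, mul_one]
    rw [LinearMap.rTensor_tmul, this, autHopf_mul D hF, autHopf_inclB D hF, projB_inclB_mul]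
    rfl

theorem facR_one : WithConv.toConv (facR D 1) = 1 := by
  ext h
  change projB D (inclH D h) = algebraMap k B (counit h)
  rw [inclH_apply, projB_tmul, Algebra.algebraMap_eq_smul_one]

/-- The group homomorphism `ν : Aut_Hopf(A, π) → Aut_Alg(B)`, `ν(F) = F_L`. -/
def nu : autHopf D →* (B ≃ₐ[k] B) where
  toFun F := AlgEquiv.ofLinearEquiv
    (LinearEquiv.ofLinearMap (facL D F.1) (facL D (F⁻¹).1)
      (by rw [← facL_mul D (F⁻¹).2, ← Subgroup.coe_mul, mul_inv_cancel]; exact facL_one D)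
      (by rw [← facL_mul D F.2, ← Subgroup.coe_mul, inv_mul_cancel]; exact facL_one D))
    (by
      have h1 : F.1 1 = 1 := by
        obtain ⟨⟨E, hE⟩, -⟩ := F.2
        rw [← hE, map_one]
      change projB D (F.1 1) = 1
      rw [h1]
      exact projB_inclB D 1)
    (fun b b' => by
      change facL D F.1 (b * b') = facL D F.1 b * facL D F.1 b'
      rw [facL_apply, inclB_mul, autHopf_mul D F.2, autHopf_inclB D F.2, projB_inclB_mul]
      rfl)
  map_one' := by
    ext b
    exact LinearMap.congr_fun (facL_one D) b
  map_mul' F G := by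
    ext b
    exact LinearMap.congr_fun (facL_mul D G.2) b

theorem nu_apply (F : autHopf D) (b : B) : nu D F b = facL D F.1 b := rfl

/-- `F_R` for `F ∈ Ker(ν)`, as a unit of the convolution algebra `Hom(H, B)`; since
`(F ∘ G)_R = G_R ⋆ F_R` on `Ker(ν)` this is a homomorphism to the opposite group. -/
def kerFacR : (nu D).ker →* ((WithConv (H →ₗ[k] B))ˣ)ᵐᵒᵖ :=
  have hm : ∀ F G : (nu D).ker, WithConv.toConv (facR D (F * G).1.1) =
      WithConv.toConv (facR D G.1.1) * WithConv.toConv (facR D F.1.1) := by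
    intro F G
    have hF : facL D F.1.1 = LinearMap.id := by
      ext b
      have := F.2
      rw [MonoidHom.mem_ker] at this
      rw [← nu_apply, this]
      rfl
    have := facR_mul D F.1.2 G.1.2
    rw [hF, LinearMap.id_comp] at this
    exact this
  { toFun := fun F => MulOpposite.op
      { val := WithConv.toConv (facR D F.1.1)
        inv := WithConv.toConv (facR D (F⁻¹).1.1)
        val_inv := by rw [← hm, inv_mul_cancel]; exact facR_one D
        inv_val := by rw [← hm, mul_inv_cancel]; exact facR_one D }
    map_one' := MulOpposite.unop_injective (Units.ext (facR_one D))
    map_mul' := fun F G => MulOpposite.unop_injective (Units.ext (hm F G)) }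

/-- `𝒩(B, H)`: the set of all `F_R`, where `F ∈ Aut_Hopf(A, π)` satisfies `F_L = Id_B`, as a group
under the convolution product. -/
def convN : Subgroup (WithConv (H →ₗ[k] B))ˣ := (kerFacR D).range.unop

/-- The elements of `𝒩(B, H)` are the maps `F_R` with `F ∈ Aut_Hopf(A, π)` and `F_L = Id_B`. -/
theorem mem_convN_iff (g : H →ₗ[k] B) :
    (∃ u ∈ convN D, u.val = WithConv.toConv g) ↔
      ∃ F ∈ autHopf D, facL D F = LinearMap.id ∧ facR D F = g := by
  constructor
  · rintro ⟨u, ⟨F, hF⟩, hu⟩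
    refine ⟨F.1.1, F.1.2, ?_, ?_⟩
    · ext b
      have := F.2
      rw [MonoidHom.mem_ker] at this
      rw [← nu_apply, this]
      rfl
    · apply WithConv.toConv_injective
      rw [← hu]
      have := congrArg (fun v => v.unop.val) hF
      exact this
  · rintro ⟨F, hF, hL, rfl⟩
    have hk : (⟨F, hF⟩ : autHopf D) ∈ (nu D).ker := by
      rw [MonoidHom.mem_ker]
      ext b
      rw [nu_apply, hL]
      rfl
    exact ⟨(kerFacR D ⟨_, hk⟩).unop, ⟨⟨_, hk⟩, rfl⟩, rfl⟩

end RadfordBiproduct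

end

open scoped TensorProduct

noncomputable section

namespace RadfordBiproduct

open TensorProduct Coalgebra

section SmashFactors

variable {k H B : Type*} [Field k] [Ring H] [HopfAlgebra k H] [Ring B] [Algebra k B]
  [Coalgebra k B] [Module H B] [IsScalarTower k H B] (D : YDHopf k H B)

/-! ### The commutation rule between the two factors of an automorphism -/

/-! Every `F` in `Aut_Hopf(A, π)` is determined by its two factors: `F(b × h) = F_L(b) F_R(h₍₁₎) ×
h₍₂₎` (`autHopf_eq_factorMap`). Applying `Π ∘ F` to `(1 × h)(b × 1) = h₍₁₎ • b × h₍₂₎` yields the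
commutation rule `facR_conv_orb`. When `F_L = Id`, it says that `g = F_R` commutes under convolution
with every orbit map. If `H` is cocommutative, replacing `b` by `S(h₍₃₎) • b` cancels the action and
shows that `g` has central values (`commute_of_conv_orb`).

Centrality makes the action well defined: for `f = G_L` and `g = F_R` with `F_L = Id`, the conjugate
`G F G⁻¹` again has left factor `Id`, and its right factor is `f ∘ g` once `f ∘ g` is allowed to
move past `G_R` (`convPostcomp_mem`).

The maps `b × h ↦ f(b) g(h₍₁₎) × h₍₂₎` compose by the rule `(g, f)(g', f') = ((f ∘ g') ⋆ g, f f')`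
for all algebra maps `f`, `f'` (`factorMap_comp`). This is the law of `𝒩(B, H)ᵒᵖ ⋊ Im(ν)`, so `Φ_ν`
is a homomorphism, and applying `Π` shows that it is injective.

For (b), the map of `(g, f)` is the map of `(g, Id)`, which lies in `Aut_Hopf(A, π)` by definition
of `𝒩(B, H)`, after `f ⊗ Id`. It remains to see that `f ⊗ Id` lies in `Aut_Hopf(A, π)` exactly when
`f` is a Yetter-Drinfel'd Hopf automorphism. -/

theorem inclB_mul_inclH (b : B) (h : H) : inclB D b * inclH D h = toBi D (b ⊗ₜ h) := by
  rw [inclH_apply, inclB_mul_toBi, mul_one]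

theorem inclH_mul_inclB (h : H) (b : B) :
    inclH D h * inclB D b = toBi D ((orb k H b).rTensor H (comul h)) := by
  rw [inclH_apply, inclB_apply, mul_def]
  simp only [LinearEquiv.symm_apply_apply, smashMul_tmul, LinearMap.rTensor]
  congr 2
  ext x y
  simp

theorem projB_toBi_rTensor_comul (g : H →ₗ[k] B) (h : H) :
    projB D (toBi D (g.rTensor H (comul h))) = g h := by
  have key : ∀ t : H ⊗[k] H, projB D (toBi D (g.rTensor H t)) =
      g (TensorProduct.rid k H ((counit (R := k) (A := H)).lTensor H t)) := by
    intro t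
    induction t using TensorProduct.induction_on with
    | zero => simp
    | add x y hx hy => simp only [map_add, hx, hy]
    | tmul x y => simp
  rw [key, lTensor_counit_comul, TensorProduct.rid_tmul, one_smul]

theorem projB_inclH_mul_inclB (h : H) (b : B) : projB D (inclH D h * inclB D b) = h • b := by
  rw [inclH_mul_inclB, projB_toBi_rTensor_comul, orb_apply]

/-- `F_R(h₍₁₎) (h₍₂₎ • F_L(b)) = F_L(h₍₁₎ • b) F_R(h₍₂₎)`. -/
theorem facR_conv_orb {F : Biproduct D ≃ₗ[k] Biproduct D} (hF : F ∈ autHopf D) (b : B) :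
    WithConv.toConv (facR D F) * WithConv.toConv (orb k H (facL D F b)) =
      WithConv.toConv (facL D F ∘ₗ orb k H b) * WithConv.toConv (facR D F) := by
  ext h
  simp only [LinearMap.convMul_apply]
  -- Both sides are `Π(F((1 × h)(b × 1)))`: on the left `F` is applied to each factor, on the right
  -- the product is expanded before `F` is applied. Left `B`-linearity of `Π` extracts the factors
  -- from `B`.
  have hl : ∀ t : H ⊗[k] H, projB D (toBi D ((facR D F).rTensor H t) * inclB D (facL D F b)) =
      LinearMap.mul' k B (TensorProduct.map (facR D F) (orb k H (facL D F b)) t) := by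
    intro t
    induction t using TensorProduct.induction_on with
    | zero => simp
    | add x y hx hy => simp only [map_add, add_mul, hx, hy]
    | tmul x y =>
      rw [LinearMap.rTensor_tmul, ← inclB_mul_inclH, mul_assoc, projB_inclB_mul,
        projB_inclH_mul_inclB]
      simp
  have hr : ∀ t : H ⊗[k] H, projB D (F (toBi D ((orb k H b).rTensor H t))) =
      LinearMap.mul' k B (TensorProduct.map (facL D F ∘ₗ orb k H b) (facR D F) t) := by
    intro t
    induction t using TensorProduct.induction_on with
    | zero => simp
    | add x y hx hy => simp only [map_add, hx, hy]
    | tmul x y =>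
      rw [LinearMap.rTensor_tmul, ← inclB_mul_inclH, autHopf_mul D hF, autHopf_inclB D hF,
        projB_inclB_mul]
      simp [facR_apply]
  rw [← hl, ← hr, ← autHopf_inclH D hF, ← autHopf_inclB D hF, ← autHopf_mul D hF,
    inclH_mul_inclB]

/-! ### Centrality of values when `H` is cocommutative. -/

/-- This is `h₍₁₎ ⊗ h₍₂₎ S(h₍₃₎) = h ⊗ 1`, from coassociativity and the antipode axiom. It serves to
cancel the action of `h₍₂₎` on `b`. -/
theorem lTensor_mul_antipode (h : H) :
    (LinearMap.mul' k H ∘ₗ (HopfAlgebra.antipode k).lTensor H).lTensor H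
      (TensorProduct.assoc k H H H ((comul (R := k) (A := H)).rTensor H (comul h))) =
        h ⊗ₜ 1 := by
  rw [coassoc_apply]
  have hc : (LinearMap.mul' k H ∘ₗ (HopfAlgebra.antipode k).lTensor H) ∘ₗ comul =
      Algebra.linearMap k H ∘ₗ counit := HopfAlgebra.mul_antipode_lTensor_comul
  rw [← LinearMap.comp_apply, ← LinearMap.lTensor_comp, hc, LinearMap.lTensor_comp,
    LinearMap.comp_apply, lTensor_counit_comul]
  simp

/-- If `H` is cocommutative, then a linear map `g : H → B` which commutes under convolution with
all orbit maps has central values. -/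
theorem commute_of_conv_orb [IsCocomm k H] (g : H →ₗ[k] B)
    (hg : ∀ b, WithConv.toConv g * WithConv.toConv (orb k H b) =
      WithConv.toConv (orb k H b) * WithConv.toConv g) (h : H) (b : B) :
    g h * b = b * g h := by
  -- Here `P(u ⊗ v) = g(u)(v • b)`, `Q(u ⊗ v) = (v • b) g(u)` and `T(x ⊗ z) = x₍₁₎ ⊗ x₍₂₎ S(z)`. The
  -- hypothesis at `S(z) • b` gives `P ∘ T = Q ∘ T`. Since `T(Δ(h)) = h ⊗ 1`, evaluation at `Δ(h)`
  -- leaves `g(h) b = b g(h)`.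
  let P : H ⊗[k] H →ₗ[k] B := LinearMap.mul' k B ∘ₗ TensorProduct.map g (orb k H b)
  let Q : H ⊗[k] H →ₗ[k] B :=
    LinearMap.mul' k B ∘ₗ TensorProduct.map (orb k H b) g ∘ₗ (TensorProduct.comm k H H).toLinearMap
  let T : H ⊗[k] H →ₗ[k] H ⊗[k] H :=
    (LinearMap.mul' k H ∘ₗ (HopfAlgebra.antipode k).lTensor H).lTensor H ∘ₗ
      (TensorProduct.assoc k H H H).toLinearMap ∘ₗ (comul (R := k) (A := H)).rTensor H
  have hP : ∀ x z, P (T (x ⊗ₜ z)) =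
      (WithConv.toConv g * WithConv.toConv (orb k H (HopfAlgebra.antipode k z • b))) x := by
    intro x z
    simp only [LinearMap.convMul_apply, T, LinearMap.comp_apply, LinearMap.rTensor_tmul]
    induction comul (R := k) x using TensorProduct.induction_on with
    | zero => simp
    | add x y hx hy => simp only [map_add, TensorProduct.add_tmul, hx, hy]
    | tmul x y => simp [P, mul_smul]
  have hQ : ∀ x z, Q (T (x ⊗ₜ z)) =
      (WithConv.toConv (orb k H (HopfAlgebra.antipode k z • b)) * WithConv.toConv g) x := by
    intro x z
    rw [LinearMap.convMul_apply]
    -- `Q` feeds the first leg to `g`, whereas the convolution feeds it to the orbit map;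
    -- cocommutativity reconciles the two.
    conv_rhs => rw [← comm_comul k x]
    simp only [T, LinearMap.comp_apply, LinearMap.rTensor_tmul]
    induction comul (R := k) x using TensorProduct.induction_on with
    | zero => simp
    | add x y hx hy => simp only [map_add, TensorProduct.add_tmul, hx, hy]
    | tmul x y => simp [Q, mul_smul]
  have hPQ : P ∘ₗ T = Q ∘ₗ T := TensorProduct.ext' fun x z => by
    refine (hP x z).trans (Eq.trans ?_ (hQ x z).symm)
    rw [hg]
  have hT : T (comul h) = h ⊗ₜ 1 := lTensor_mul_antipode h
  have := LinearMap.congr_fun hPQ (comul h)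
  simpa [hT, P, Q] using this

end SmashFactors

section SemidirectAction

variable {k H B : Type*} [Field k] [Ring H] [HopfAlgebra k H] [Ring B] [Algebra k B]
  [Coalgebra k B] [Module H B] [IsScalarTower k H B] (D : YDHopf k H B)

/-! ### The maps `b × h ↦ f(b) g(h₍₁₎) × h₍₂₎` -/

/-- The map `b × h ↦ f(b) g(h₍₁₎) × h₍₂₎`. -/
def factorMap (f : B →ₗ[k] B) (g : H →ₗ[k] B) : Biproduct D →ₗ[k] Biproduct D :=
  (toBi D).toLinearMap ∘ₗ (LinearMap.mul' k B).rTensor H ∘ₗ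
    (TensorProduct.assoc k B B H).symm.toLinearMap ∘ₗ
    TensorProduct.map f (g.rTensor H ∘ₗ comul) ∘ₗ (toBi D).symm.toLinearMap

theorem factorMap_tmul (f : B →ₗ[k] B) (g : H →ₗ[k] B) (b : B) (h : H) :
    factorMap D f g (toBi D (b ⊗ₜ h)) =
      toBi D ((LinearMap.mulLeft k (f b) ∘ₗ g).rTensor H (comul h)) := by
  simp only [factorMap, LinearMap.comp_apply, LinearEquiv.coe_coe, LinearEquiv.symm_apply_apply,
    TensorProduct.map_tmul]
  congr 1
  induction comul (R := k) h using TensorProduct.induction_on with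
  | zero => simp
  | add x y hx hy => simp only [map_add, TensorProduct.tmul_add, hx, hy]
  | tmul x y => simp

/-- Since `f` is multiplicative, both sides send `b × h` to `f(f'(b)) f(g'(h₍₁₎)) g(h₍₂₎) × h₍₃₎`,
up to coassociativity. The map `Ψ` assembles this from the iterated coproduct. The factor `f ∘ g'`
stands before `g`, which is why the opposite group of `𝒩(B, H)` appears. -/
theorem factorMap_comp (f f' : B →ₐ[k] B) (g g' : WithConv (H →ₗ[k] B)) :
    factorMap D f.toLinearMap g.ofConv ∘ₗ factorMap D f'.toLinearMap g'.ofConv =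
      factorMap D (f.comp f').toLinearMap
        (WithConv.toConv (f.toLinearMap ∘ₗ g'.ofConv) * g).ofConv := by
  refine ext_tmul D fun b h => ?_
  rw [LinearMap.comp_apply, factorMap_tmul, factorMap_tmul]
  let Ψ : H ⊗[k] (H ⊗[k] H) →ₗ[k] B ⊗[k] H :=
    (LinearMap.mul' k B).rTensor H ∘ₗ (TensorProduct.assoc k B B H).symm.toLinearMap ∘ₗ
      TensorProduct.map (LinearMap.mulLeft k (f (f' b)) ∘ₗ f.toLinearMap ∘ₗ g'.ofConv)
        (g.ofConv.rTensor H)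
  have hl : ∀ t : H ⊗[k] H, factorMap D f.toLinearMap g.ofConv
      (toBi D ((LinearMap.mulLeft k (f'.toLinearMap b) ∘ₗ g'.ofConv).rTensor H t)) =
        toBi D (Ψ ((comul (R := k) (A := H)).lTensor H t)) := by
    intro t
    induction t using TensorProduct.induction_on with
    | zero => simp
    | add x y hx hy => simp only [map_add, hx, hy]
    | tmul x y =>
      rw [LinearMap.rTensor_tmul, factorMap_tmul, LinearMap.lTensor_tmul]
      congr 1
      induction comul (R := k) y using TensorProduct.induction_on with
      | zero => simp
      | add x y hx hy => simp only [map_add, TensorProduct.tmul_add, hx, hy]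
      | tmul u v => simp [Ψ, mul_assoc]
  have hr : ∀ t : H ⊗[k] H, (LinearMap.mulLeft k ((f.comp f').toLinearMap b) ∘ₗ
      (WithConv.toConv (f.toLinearMap ∘ₗ g'.ofConv) * g).ofConv).rTensor H t =
        Ψ (TensorProduct.assoc k H H H ((comul (R := k) (A := H)).rTensor H t)) := by
    intro t
    induction t using TensorProduct.induction_on with
    | zero => simp
    | add x y hx hy => simp only [map_add, hx, hy]
    | tmul x y =>
      simp only [LinearMap.rTensor_tmul, LinearMap.comp_apply]
      change (LinearMap.mulLeft k _ ((WithConv.toConv (f.toLinearMap ∘ₗ g'.ofConv) * g) x)) ⊗ₜ y = _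
      rw [LinearMap.convMul_apply]
      induction comul (R := k) x using TensorProduct.induction_on with
      | zero => simp
      | add x y hx hy => simp only [map_add, TensorProduct.add_tmul, hx, hy]
      | tmul u v => simp [Ψ, mul_assoc]
  rw [hl, hr, coassoc_apply]

theorem rTensor_mulLeft_counit (b : B) (h : H) :
    (LinearMap.mulLeft k b ∘ₗ Algebra.linearMap k B ∘ₗ counit).rTensor H (comul h) = b ⊗ₜ h := by
  rw [← LinearMap.comp_assoc, LinearMap.rTensor_comp, LinearMap.comp_apply, rTensor_counit_comul]
  simp

theorem factorMap_counit_tmul (f : B →ₗ[k] B) (b : B) (h : H) :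
    factorMap D f (1 : WithConv (H →ₗ[k] B)).ofConv (toBi D (b ⊗ₜ h)) = toBi D (f b ⊗ₜ h) := by
  rw [factorMap_tmul, LinearMap.convOne_def, WithConv.ofConv_toConv, rTensor_mulLeft_counit]

theorem factorMap_id_one :
    factorMap D LinearMap.id (1 : WithConv (H →ₗ[k] B)).ofConv = LinearMap.id :=
  ext_tmul D fun b h => by rw [factorMap_counit_tmul]; rfl

/-- By `autHopf_tmul`, `F` is determined by `Π ∘ F`; multiplicativity on `(b × 1)(1 × h)` then
splits `Π(F(b × h))` as `F_L(b) F_R(h)`. -/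
theorem autHopf_eq_factorMap {F : Biproduct D ≃ₗ[k] Biproduct D} (hF : F ∈ autHopf D) :
    F.toLinearMap = factorMap D (facL D F) (facR D F) := by
  refine ext_tmul D fun b h => ?_
  rw [LinearEquiv.coe_coe, autHopf_tmul D hF, factorMap_tmul]
  congr 3
  ext x
  simp only [LinearMap.comp_apply, LinearEquiv.coe_coe, TensorProduct.mk_apply]
  rw [← inclB_mul_inclH, autHopf_mul D hF, autHopf_inclB D hF, projB_inclB_mul]
  rfl

/-! ### The action of `Im(ν)` on `𝒩(B, H)` -/

theorem convN_central [IsCocomm k H] {u : (WithConv (H →ₗ[k] B))ˣ} (hu : u ∈ convN D)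
    (h : H) (b : B) : u.val h * b = b * u.val h := by
  obtain ⟨F, hF, hL, hR⟩ := (mem_convN_iff D u.val.ofConv).1 ⟨u, hu, rfl⟩
  refine commute_of_conv_orb u.val.ofConv (fun b => ?_) h b
  have := facR_conv_orb D hF b
  rwa [hL, hR, LinearMap.id_apply, LinearMap.id_comp] at this

/-- Composition with an algebra map, as an endomorphism of the convolution monoid. -/
def convPostcomp (f : B →ₐ[k] B) : WithConv (H →ₗ[k] B) →* WithConv (H →ₗ[k] B) where
  toFun g := WithConv.toConv (f.toLinearMap ∘ₗ g.ofConv)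
  map_one' := by
    ext h
    simp [LinearMap.convOne_def]
  map_mul' g g' := by
    rw [LinearMap.algHom_comp_convMul_distrib]

theorem convPostcomp_mem [IsCocomm k H] {f : B ≃ₐ[k] B} (hf : f ∈ (nu D).range)
    {u : (WithConv (H →ₗ[k] B))ˣ} (hu : u ∈ convN D) :
    Units.map (convPostcomp (f : B →ₐ[k] B)) u ∈ convN D := by
  obtain ⟨G, rfl⟩ := hf
  obtain ⟨F, hF, hL, hR⟩ := (mem_convN_iff D u.val.ofConv).1 ⟨u, hu, rfl⟩
  have hG := G.2
  have hG' := (G⁻¹).2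
  have hGL : facL D G.1 = (nu D G : B →ₐ[k] B).toLinearMap := rfl
  -- The witness for `f ∘ g` is the conjugate `G F G⁻¹`, whose left factor is `G_L (G⁻¹)_L = Id`.
  obtain ⟨u', hu', h'⟩ := (mem_convN_iff D (facR D (G.1 * F * (G⁻¹).1))).2
    ⟨_, mul_mem (mul_mem hG hF) hG', by
      rw [facL_mul D hG', facL_mul D hF, hL, LinearMap.comp_id, ← facL_mul D hG',
        ← Subgroup.coe_mul, mul_inv_cancel]
      exact facL_one D, rfl⟩
  convert hu'
  ext1
  rw [h', facR_mul D (mul_mem hG hF) hG', facR_mul D hG hF, facL_mul D hF, hL, LinearMap.comp_id]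
  -- The right factor of the conjugate is `(G_L ∘ (G⁻¹)_R) ⋆ (G_L ∘ F_R) ⋆ G_R`. Exchanging the last
  -- two terms lets the first and `G_R` combine into `(G G⁻¹)_R = 1`.
  have hcomm : WithConv.toConv (facL D G.1 ∘ₗ facR D F) * WithConv.toConv (facR D G.1) =
      WithConv.toConv (facR D G.1) * WithConv.toConv (facL D G.1 ∘ₗ facR D F) := by
    ext h
    -- The flip of `Δ(h)` is kept on the left side only, so that both sides pair the same legs with
    -- the same maps.
    rw [LinearMap.convMul_apply, LinearMap.convMul_apply, ← comm_comul k h]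
    nth_rewrite 2 [comm_comul k h]
    induction comul (R := k) h using TensorProduct.induction_on with
    | zero => simp
    | add x y hx hy => simp only [map_add, hx, hy]
    | tmul x y =>
      -- Bijectivity of `f = ν(G)` transports centrality from `g` to `f ∘ g`: `G_R(x)` is the image
      -- under `f` of an element that commutes with `g(y)`.
      have := congrArg (nu D G) (convN_central D hu y ((nu D G).symm (facR D G.1 x)))
      simp only [map_mul, AlgEquiv.apply_symm_apply] at this
      simpa [hR, hGL] using this
  rw [hcomm, ← mul_assoc, ← facR_mul D hG hG', ← Subgroup.coe_mul, mul_inv_cancel]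
  rw [Subgroup.coe_one, facR_one, one_mul, hR]
  rfl

/-- The action `f • g = f ∘ g` of `Im(ν)` on `𝒩(B, H)ᵒᵖ`. -/
abbrev rangeAction [IsCocomm k H] : MulDistribMulAction (nu D).range (convN D)ᵐᵒᵖ where
  smul f g := MulOpposite.op ⟨_, convPostcomp_mem D f.2 g.unop.2⟩
  one_smul _ := MulOpposite.unop_injective (Subtype.ext (Units.ext rfl))
  mul_smul _ _ _ := MulOpposite.unop_injective (Subtype.ext (Units.ext rfl))
  smul_one _ := MulOpposite.unop_injective (Subtype.ext (map_one _))
  smul_mul _ _ _ := MulOpposite.unop_injective (Subtype.ext (map_mul _ _ _))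

/-- The automorphism of `Aut_Hopf(A, π)` attached to an element of `𝒩(B, H)`. -/
theorem exists_autHopf_eq_factorMap {u : (WithConv (H →ₗ[k] B))ˣ} (hu : u ∈ convN D) :
    ∃ F ∈ autHopf D, F.toLinearMap = factorMap D LinearMap.id u.val.ofConv := by
  obtain ⟨F, hF, hL, hR⟩ := (mem_convN_iff D u.val.ofConv).1 ⟨u, hu, rfl⟩
  exact ⟨F, hF, by rw [autHopf_eq_factorMap D hF, hL, hR]⟩

end SemidirectAction

section YetterDrinfeldAutomorphisms

variable {k H B : Type*} [Field k] [Ring H] [HopfAlgebra k H] [Ring B] [Algebra k B]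
  [Coalgebra k B] [Module H B] [IsScalarTower k H B] (D : YDHopf k H B)

/-! ### The maps `b × h ↦ f(b) × h` -/

theorem autHopf_comul {F : Biproduct D ≃ₗ[k] Biproduct D} (hF : F ∈ autHopf D) (a : Biproduct D) :
    comul (R := k) (F a) = TensorProduct.map F.toLinearMap F.toLinearMap (comul a) := by
  obtain ⟨⟨E, hE⟩, -⟩ := hF
  have hEF : ((E : Biproduct D →ₗc[k] Biproduct D) : Biproduct D →ₗ[k] Biproduct D) =
      F.toLinearMap := LinearMap.ext hE
  rw [← hE, ← hEF]
  exact (CoalgHomClass.map_comp_comul_apply E a).symm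

theorem autHopf_counit {F : Biproduct D ≃ₗ[k] Biproduct D} (hF : F ∈ autHopf D)
    (a : Biproduct D) : counit (R := k) (F a) = counit (R := k) a := by
  obtain ⟨⟨E, hE⟩, -⟩ := hF
  rw [← hE]
  exact CoalgHomClass.counit_comp_apply E a

/-! ### Recovering the coproduct and the coaction of `B` from the smash coproduct. -/

theorem counit_toBi (b : B) (h : H) :
    counit (R := k) (toBi D (b ⊗ₜ h)) = counit (R := k) b * counit (R := k) h := by
  change LinearMap.mul' k k (TensorProduct.map counit counit ((toBi D).symm (toBi D (b ⊗ₜ h)))) = _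
  simp

theorem comul_toBi (x : B ⊗[k] H) : comul (R := k) (toBi D x) =
    TensorProduct.map (toBi D).toLinearMap (toBi D).toLinearMap (smashComul D x) := rfl

/-- The map `x ⊗ ((a ⊗ y) ⊗ (u ⊗ v)) ↦ (x ⊗ a u) ⊗ (y ⊗ v)`, which assembles the smash coproduct of
`b ⊗ h` from `b₍₁₎ ⊗ (ρ(b₍₂₎) ⊗ Δ(h))`. -/
def smashShuffle (k H B : Type*) [Field k] [Ring H] [HopfAlgebra k H] [Ring B] [Algebra k B] :
    B ⊗[k] ((H ⊗[k] B) ⊗[k] (H ⊗[k] H)) →ₗ[k] (B ⊗[k] H) ⊗[k] (B ⊗[k] H) :=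
  (TensorProduct.assoc k B H (B ⊗[k] H)).symm.toLinearMap ∘ₗ
    ((LinearMap.mul' k H).rTensor (B ⊗[k] H) ∘ₗ
      (TensorProduct.tensorTensorTensorComm k H B H H).toLinearMap).lTensor B

theorem smashComul_tmul (b : B) (h : H) : smashComul D (b ⊗ₜ h) = smashShuffle k H B
    (((TensorProduct.mk k (H ⊗[k] B) (H ⊗[k] H)).flip (comul h) ∘ₗ D.ρ).lTensor B (comul b)) := by
  simp only [smashComul, LinearMap.comp_apply, LinearMap.rTensor_tmul]
  induction comul (R := k) b using TensorProduct.induction_on with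
  | zero => simp
  | add x y hx hy => simp only [map_add, TensorProduct.add_tmul, hx, hy]
  | tmul x y => simp [smashShuffle]

/-- With `Δ(1) = 1 ⊗ 1` as second input, `Π ⊗ Π` applies the counit of `H` to `z₍₂₎₍₋₁₎`, and
counitality of `ρ` restores the second leg of `z`. -/
theorem map_projB_smashShuffle (z : B ⊗[k] B) :
    TensorProduct.map (projB D ∘ₗ (toBi D).toLinearMap) (projB D ∘ₗ (toBi D).toLinearMap)
      (smashShuffle k H B (((TensorProduct.mk k (H ⊗[k] B) (H ⊗[k] H)).flip (1 ⊗ₜ 1) ∘ₗ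
        D.ρ).lTensor B z)) = z := by
  induction z using TensorProduct.induction_on with
  | zero => simp
  | add x y hx hy => simp only [map_add, hx, hy]
  | tmul x y =>
    conv_rhs => rw [← D.coact_counit y]
    simp only [LinearMap.lTensor_tmul, LinearMap.comp_apply]
    induction D.ρ y using TensorProduct.induction_on with
    | zero => simp
    | add x y hx hy => simp only [map_add, TensorProduct.tmul_add, hx, hy]
    | tmul a y => simp [smashShuffle, TensorProduct.smul_tmul]

theorem projB_comul_inclB (b : B) :
    TensorProduct.map (projB D) (projB D) (comul (R := k) (inclB D b)) = comul (R := k) b := by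
  rw [inclB_apply, comul_toBi, ← LinearMap.comp_apply, ← TensorProduct.map_comp, smashComul_tmul,
    Bialgebra.comul_one, Algebra.TensorProduct.one_def, map_projB_smashShuffle]

/-- Here `π` applies the counit of `B` to the first leg and keeps the coaction component in `H`, so
that all of `ρ` of the second leg survives. -/
theorem map_projH_projB_smashShuffle (z : B ⊗[k] B) :
    TensorProduct.map (projH D ∘ₗ (toBi D).toLinearMap) (projB D ∘ₗ (toBi D).toLinearMap)
      (smashShuffle k H B (((TensorProduct.mk k (H ⊗[k] B) (H ⊗[k] H)).flip (1 ⊗ₜ 1) ∘ₗ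
        D.ρ).lTensor B z)) =
      D.ρ (TensorProduct.lid k B ((counit (R := k) (A := B)).rTensor B z)) := by
  induction z using TensorProduct.induction_on with
  | zero => simp
  | add x y hx hy => simp only [map_add, hx, hy]
  | tmul x y =>
    simp only [LinearMap.lTensor_tmul, LinearMap.rTensor_tmul, LinearMap.comp_apply,
      TensorProduct.lid_tmul, map_smul]
    induction D.ρ y using TensorProduct.induction_on with
    | zero => simp
    | add x y hx hy => simp only [map_add, TensorProduct.tmul_add, smul_add, hx, hy]
    | tmul a y => simp [smashShuffle, TensorProduct.smul_tmul']

theorem projH_projB_comul_inclB (b : B) :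
    TensorProduct.map (projH D) (projB D) (comul (R := k) (inclB D b)) = D.ρ b := by
  rw [inclB_apply, comul_toBi, ← LinearMap.comp_apply, ← TensorProduct.map_comp, smashComul_tmul,
    Bialgebra.comul_one, Algebra.TensorProduct.one_def, map_projH_projB_smashShuffle,
    rTensor_counit_comul, TensorProduct.lid_tmul, one_smul]

/-- The linear automorphism `b × h ↦ f(b) × h`. -/
def leftFactorEquiv (f : B ≃ₐ[k] B) : Biproduct D ≃ₗ[k] Biproduct D :=
  (toBi D).symm ≪≫ₗ TensorProduct.congr f.toLinearEquiv (LinearEquiv.refl k H) ≪≫ₗ toBi D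

theorem leftFactorEquiv_tmul (f : B ≃ₐ[k] B) (b : B) (h : H) :
    leftFactorEquiv D f (toBi D (b ⊗ₜ h)) = toBi D (f b ⊗ₜ h) := by
  simp [leftFactorEquiv]

theorem mem_autYDHopf_of_leftFactorEquiv_mem {f : B ≃ₐ[k] B}
    (hf : leftFactorEquiv D f ∈ autHopf D) : f ∈ autYDHopf D := by
  have hI : ∀ b, leftFactorEquiv D f (inclB D b) = inclB D (f b) :=
    fun b => leftFactorEquiv_tmul D f b 1
  have hB : projB D ∘ₗ (leftFactorEquiv D f).toLinearMap = f.toLinearMap ∘ₗ projB D :=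
    ext_tmul D fun b h => by simp [leftFactorEquiv_tmul]
  have hH : projH D ∘ₗ (leftFactorEquiv D f).toLinearMap = projH D := LinearMap.ext hf.2
  have hL : facL D (leftFactorEquiv D f) = f.toLinearMap := by
    ext b
    rw [facL_apply, hI, projB_inclB]
    rfl
  have hR : WithConv.toConv (facR D (leftFactorEquiv D f)) = 1 := by
    ext h
    change projB D (leftFactorEquiv D f (inclH D h)) = algebraMap k B (counit h)
    rw [inclH_apply, leftFactorEquiv_tmul, projB_tmul, map_one, Algebra.algebraMap_eq_smul_one]
  refine ⟨⟨{ f with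
    map_smul' := map_smul f
    counit_comp := ?_
    map_comp_comul := ?_ }, fun b => rfl⟩, fun h b => ?_, fun b => ?_⟩
  · refine LinearMap.ext fun b => ?_
    have := autHopf_counit D hf (inclB D b)
    rw [hI, inclB_apply, inclB_apply, counit_toBi, counit_toBi] at this
    simpa using this
  · refine LinearMap.ext fun b => ?_
    have := autHopf_comul D hf (inclB D b)
    rw [hI] at this
    have := congrArg (TensorProduct.map (projB D) (projB D)) this
    rw [projB_comul_inclB, ← LinearMap.comp_apply, ← TensorProduct.map_comp, hB,
      TensorProduct.map_comp, LinearMap.comp_apply, projB_comul_inclB] at this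
    exact this.symm
  -- As `F_R` is the convolution unit, the commutation rule reduces to `h • f(b) = f(h • b)`.
  · have := facR_conv_orb D hf b
    rw [hL, hR, one_mul, mul_one] at this
    exact (congrArg (fun g : WithConv (H →ₗ[k] B) => g h) this).symm
  -- `π ⊗ Π` turns `Δ(b × 1)` into `ρ(b)`; as `π ∘ F = π` and `Π ∘ F = f ∘ Π` for `F = f ⊗ Id`,
  -- comultiplicativity becomes colinearity of `f`.
  · have := autHopf_comul D hf (inclB D b)
    rw [hI] at this
    have := congrArg (TensorProduct.map (projH D) (projB D)) this
    rw [projH_projB_comul_inclB, ← LinearMap.comp_apply, ← TensorProduct.map_comp, hB, hH] at this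
    rw [this, ← projH_projB_comul_inclB, ← LinearMap.lTensor_comp_map]
    rfl

theorem leftFactorEquiv_mul {f : B ≃ₐ[k] B} (hf : ∀ (h : H) (b : B), f (h • b) = h • f b)
    (x y : Biproduct D) : leftFactorEquiv D f (x * y) =
      leftFactorEquiv D f x * leftFactorEquiv D f y := by
  refine LinearMap.congr_fun (f := (leftFactorEquiv D f).toLinearMap ∘ₗ LinearMap.mulRight k y)
    (g := LinearMap.mulRight k (leftFactorEquiv D f y) ∘ₗ (leftFactorEquiv D f).toLinearMap)
    (ext_tmul D fun b h => ?_) x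
  refine LinearMap.congr_fun
    (f := (leftFactorEquiv D f).toLinearMap ∘ₗ LinearMap.mulLeft k (toBi D (b ⊗ₜ h)))
    (g := LinearMap.mulLeft k (leftFactorEquiv D f (toBi D (b ⊗ₜ h))) ∘ₗ
      (leftFactorEquiv D f).toLinearMap) (ext_tmul D fun b' h' => ?_) y
  simp only [LinearMap.comp_apply, LinearEquiv.coe_coe, LinearMap.mulLeft_apply,
    leftFactorEquiv_tmul, mul_def, LinearEquiv.symm_apply_apply, smashMul_tmul]
  induction comul (R := k) h using TensorProduct.induction_on with
  | zero => simp
  | add x y hx hy => simp only [map_add, hx, hy]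
  | tmul u v => simp [leftFactorEquiv_tmul, hf]

theorem leftFactorEquiv_comul {f : B ≃ₐ[k] B}
    (hf : ∀ b, comul (R := k) (f b) = TensorProduct.map f.toLinearMap f.toLinearMap (comul b))
    (hf' : ∀ b, D.ρ (f b) = f.toLinearMap.lTensor H (D.ρ b)) (x : Biproduct D) :
    TensorProduct.map (leftFactorEquiv D f).toLinearMap (leftFactorEquiv D f).toLinearMap
      (comul (R := k) x) = comul (R := k) (leftFactorEquiv D f x) := by
  refine LinearMap.congr_fun (f := TensorProduct.map (leftFactorEquiv D f).toLinearMap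
    (leftFactorEquiv D f).toLinearMap ∘ₗ comul) (g := comul ∘ₗ (leftFactorEquiv D f).toLinearMap)
    (ext_tmul D fun b h => ?_) x
  simp only [LinearMap.comp_apply, LinearEquiv.coe_coe, leftFactorEquiv_tmul, comul_toBi,
    smashComul_tmul, hf]
  induction comul (R := k) b using TensorProduct.induction_on with
  | zero => simp
  | add x y hx hy => simp only [map_add, hx, hy]
  | tmul x y =>
    simp only [LinearMap.lTensor_tmul, TensorProduct.map_tmul, LinearMap.comp_apply,
      AlgEquiv.toLinearMap_apply, hf', LinearMap.flip_apply, TensorProduct.mk_apply]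
    induction D.ρ y using TensorProduct.induction_on with
    | zero => simp
    | add x y hx hy => simp only [map_add, TensorProduct.add_tmul, TensorProduct.tmul_add, hx, hy]
    | tmul a y =>
    induction comul (R := k) h using TensorProduct.induction_on with
    | zero => simp
    | add x y hx hy => simp only [map_add, TensorProduct.tmul_add, hx, hy]
    | tmul u v => simp [smashShuffle, leftFactorEquiv_tmul]

theorem leftFactorEquiv_mem {f : B ≃ₐ[k] B} (hf : f ∈ autYDHopf D) :
    leftFactorEquiv D f ∈ autHopf D := by
  obtain ⟨⟨E, hE⟩, hs, hρ⟩ := hf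
  have hEf : ((E : B →ₗc[k] B) : B →ₗ[k] B) = f.toLinearMap := LinearMap.ext hE
  have hc : ∀ b, comul (R := k) (f b) =
      TensorProduct.map f.toLinearMap f.toLinearMap (comul b) := fun b => by
    rw [← hE, ← hEf]
    exact (CoalgHomClass.map_comp_comul_apply E b).symm
  have he : ∀ b, counit (R := k) (f b) = counit (R := k) b := fun b => by
    rw [← hE]
    exact CoalgHomClass.counit_comp_apply E b
  refine ⟨⟨{ leftFactorEquiv D f with
    map_mul' := leftFactorEquiv_mul D hs
    counit_comp := ext_tmul D fun b h => ?_
    map_comp_comul := LinearMap.ext (leftFactorEquiv_comul D hc hρ) }, fun a => rfl⟩, ?_⟩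
  · change counit (R := k) (leftFactorEquiv D f (toBi D (b ⊗ₜ h))) = _
    rw [leftFactorEquiv_tmul, counit_toBi, counit_toBi, he]
  · refine LinearMap.congr_fun (f := projH D ∘ₗ (leftFactorEquiv D f).toLinearMap) (g := projH D)
      (ext_tmul D fun b h => ?_)
    simp [leftFactorEquiv_tmul, he]

end YetterDrinfeldAutomorphisms

section Semidirect

variable {k H B : Type*} [Field k] [Ring H] [HopfAlgebra k H] [Ring B] [Algebra k B]
  [Coalgebra k B] [Module H B] [IsScalarTower k H B] [IsCocomm k H] (D : YDHopf k H B)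

/-! ### The semidirect product `𝒩(B, H)ᵒᵖ ⋊ Im(ν)` -/

/-- The action of `Im(ν)` on `𝒩(B, H)ᵒᵖ` by group automorphisms, `φ(f)(g) = f ∘ g`. -/
def rangeMulAut : (nu D).range →* MulAut (convN D)ᵐᵒᵖ :=
  letI := rangeAction D
  MulDistribMulAction.toMulAut (nu D).range (convN D)ᵐᵒᵖ

/-- The homomorphism from the semidirect product to the endomorphisms of the vector space `A`,
which sends `(g, f)` to `b × h ↦ f(b) g(h₍₁₎) × h₍₂₎`. -/
def semidirectEnd :
    (convN D)ᵐᵒᵖ ⋊[rangeMulAut D] (nu D).range →* Module.End k (Biproduct D) where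
  toFun x := factorMap D x.right.1.toLinearMap x.left.unop.1.1.ofConv
  map_one' := factorMap_id_one D
  -- In `𝒩(B, H)ᵒᵖ` the product of `g` with `f ∘ g'` is the convolution `(f ∘ g') ⋆ g`, the very one
  -- in `factorMap_comp`.
  map_mul' x y := (factorMap_comp D (x.right.1 : B →ₐ[k] B) (y.right.1 : B →ₐ[k] B)
    x.left.unop.1.1 y.left.unop.1.1).symm

theorem semidirectEnd_tmul (x : (convN D)ᵐᵒᵖ ⋊[rangeMulAut D] (nu D).range) (b : B) (h : H) :
    semidirectEnd D x (toBi D (b ⊗ₜ h)) = toBi D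
      ((LinearMap.mulLeft k (x.right.1 b) ∘ₗ x.left.unop.1.1.ofConv).rTensor H (comul h)) :=
  factorMap_tmul D _ _ b h

/-- For an element of the kernel, `Π` gives `f(b) g(h) = ε(h) b`: putting `b = 1` yields `g = ε(·)
1`, then `h = 1` yields `f = Id`. -/
theorem semidirectEnd_injective : Function.Injective (semidirectEnd D) := by
  rw [injective_iff_map_eq_one]
  intro x hx
  have key : ∀ b h, x.right.1 b * x.left.unop.1.1.ofConv h = counit (R := k) h • b := by
    intro b h
    have := congrArg (fun E : Module.End k (Biproduct D) => projB D (E (toBi D (b ⊗ₜ h)))) hx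
    rwa [semidirectEnd_tmul, projB_toBi_rTensor_comul, Module.End.one_apply, projB_tmul] at this
  have hl : x.left = 1 := by
    refine MulOpposite.unop_injective (Subtype.ext (Units.ext (WithConv.ext
      (LinearMap.ext fun h => ?_))))
    have := key 1 h
    rw [map_one, one_mul, ← Algebra.algebraMap_eq_smul_one] at this
    exact this
  refine SemidirectProduct.ext hl (Subtype.ext (AlgEquiv.ext fun b => ?_))
  have := key b 1
  rw [hl] at this
  change x.right.1 b * algebraMap k B (counit (1 : H)) = _ at this
  simpa using this

/-- The map of `(g, f)` is `G ∘ (f ⊗ Id)` with `G` in the subgroup `Aut_Hopf(A, π)`, so `G` can be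
cancelled and only `f ⊗ Id` matters. -/
theorem exists_autHopf_eq_semidirectEnd_iff
    (x : (convN D)ᵐᵒᵖ ⋊[rangeMulAut D] (nu D).range) :
    (∃ F ∈ autHopf D, F.toLinearMap = semidirectEnd D x) ↔ x.right.1 ∈ autYDHopf D := by
  obtain ⟨G, hG, hGx⟩ := exists_autHopf_eq_factorMap D x.left.unop.2
  have hfac : (G * leftFactorEquiv D x.right.1).toLinearMap = semidirectEnd D x := by
    refine ext_tmul D fun b h => ?_
    change G.toLinearMap (leftFactorEquiv D x.right.1 (toBi D (b ⊗ₜ h))) = _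
    rw [leftFactorEquiv_tmul, hGx, factorMap_tmul, semidirectEnd_tmul]
    rfl
  constructor
  · rintro ⟨F, hF, hFx⟩
    refine mem_autYDHopf_of_leftFactorEquiv_mem D ?_
    rw [← hfac, LinearEquiv.toLinearMap_inj] at hFx
    rwa [hFx, Subgroup.mul_mem_cancel_left _ hG] at hF
  · exact fun hx => ⟨_, mul_mem hG (leftFactorEquiv_mem D hx), hfac⟩

end Semidirect

end RadfordBiproduct

end

theorem mainTheorem8 {k H B : Type*} [Field k] [Ring H] [HopfAlgebra k H] [Ring B] [Algebra k B]
    [Coalgebra k B] [Module H B] [IsScalarTower k H B] [Coalgebra.IsCocomm k H]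
    (D : RadfordBiproduct.YDHopf k H B) :
    ∃ φ : (RadfordBiproduct.nu D).range →* MulAut (RadfordBiproduct.convN D)ᵐᵒᵖ,
      (∀ (f : (RadfordBiproduct.nu D).range) (g : (RadfordBiproduct.convN D)ᵐᵒᵖ) (h : H),
        (φ f g).unop.1.1 h = f.1 (g.unop.1.1 h)) ∧
      ∃ Φ : (RadfordBiproduct.convN D)ᵐᵒᵖ ⋊[φ] (RadfordBiproduct.nu D).range →*
          Equiv.Perm (RadfordBiproduct.Biproduct D),
        (∀ x, IsLinearMap k (Φ x)) ∧
        (∀ x (b : B) (h : H), Φ x (RadfordBiproduct.toBi D (b ⊗ₜ[k] h)) =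
          RadfordBiproduct.toBi D
            ((LinearMap.mulLeft k (x.right.1 b) ∘ₗ x.left.unop.1.1.ofConv).rTensor H
              (Coalgebra.comul h))) ∧
        Function.Injective Φ ∧
        ∀ x, (∃ F ∈ RadfordBiproduct.autHopf D, ∀ a, F a = Φ x a) ↔
          x.right.1 ∈ RadfordBiproduct.autYDHopf D := by
  -- A monoid homomorphism from a group to self-maps of `A` lands in permutations, so
  -- `MonoidHom.toHomPerm` supplies bijectivity of each `Φ x`.
  refine ⟨RadfordBiproduct.rangeMulAut D, fun f g h => rfl, MonoidHom.toHomPerm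
    { toFun := fun x => (RadfordBiproduct.semidirectEnd D x : _ → _)
      map_one' := by rw [map_one]; rfl
      map_mul' := fun x y => by rw [map_mul]; rfl },
    fun x => (RadfordBiproduct.semidirectEnd D x).isLinear,
    RadfordBiproduct.semidirectEnd_tmul D, fun x y hxy => ?_, fun x => ?_⟩
  · exact RadfordBiproduct.semidirectEnd_injective D
      (LinearMap.ext fun a => congrArg (fun p : Equiv.Perm _ => p a) hxy)
  · rw [← RadfordBiproduct.exists_autHopf_eq_semidirectEnd_iff D x]
    exact exists_congr fun F => and_congr_right fun _ =>
      ⟨fun h => LinearMap.ext h, fun h => LinearMap.congr_fun h⟩
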